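/- Let $S$ be an inverse semigroup (inverses written $s^*$) with set of idempotents $E$, and suppose $S$ is quasi-countable: there is a countable $X\subseteq S$ such that $S$ is generated, as an inverse semigroup, by $X\cup E$. Write $s\le t$ for the natural partial order $ss^*t=s$. Let $\hat E_0$ be the set of nonempty filters of the semilattice $E$, put $D_e=\{\xi\in\hat E_0: e\in\xi\}$, and give $\hat E_0$ the topology with basis the sets $D_e\cap D_{e_1}^c\cap\dots\cap D_{e_n}^c$ with $e_1,\dots,e_n<e$. For $\xi\in D_{s^*s}$ put $\theta_s(\xi)=\{e\in E: e\ge sfs^*\text{ for some }f\in\xi\}$. Let $G$ be the universal groupoid of $S$: the set of germs $[s,\xi]$ with $s\in S$, $\xi\in D_{s^*s}$, where $[s,\xi]=[t,\zeta]$ iff $\xi=\zeta$ and $se=te$ for some $e\in\xi$; the source of $[s,\xi]$ is $\xi$ and its range is $\theta_s(\xi)$; $[s,\theta_t(\xi)][t,\xi]=[st,\xi]$ and $[s,\xi]^{-1}=[s^*,\theta_s(\xi)]$; the unit space is $G^{(0)}=\{[e,\xi]:e\in E,\ \xi\in D_e\}$; the sets $\{[s,\xi]:\xi\in U\}$, with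 $s\in S$ and $U\subseteq D_{s^*s}$ open, form a basis of the topology. Suppose that $G$ is Hausdorff. A length function on $S$ is a map $l:S\to[0,\infty)$ with $l(s)=0\iff s\in E$, $l(s^*)=l(s)$ and $l(st)\le l(s)+l(t)$ for all $s,t\in S$. It is uniformly discrete if there is $c>0$ with $l(s)\ge c$ for all $s\notin E$. A finite set $F\subseteq S$ witnesses $r$-properness of $l$ if every $s$ with $0<l(s)\le r$ satisfies $s\le m$ for some $m\in F$; $l$ is proper if such an $F$ exists for every $r\ge0$, and tightly proper if for every $r\ge 0$ there is such an $F$ with moreover $l(m)\le r$ for all $m\in F$. A length function on $G$ is a map $L:G\to[0,\infty)$ with $L(g)=0\iff g\in G^{(0)}$, $L(g^{-1})=L(g)$, and $L(gh)\le L(g)+L(h)$ whenever $g,h$ are composable. It is uniformly discrete if there is $c>0$ with $L(g)\ge c$ for all $g\notin G^{(0)}$. A map $L:G\to[0,\infty)$ is proper if every $K\subseteq G\setminus G^{(0)}$ on which $L$ is bounded has compact closure, and controlled if $L$ is bounded on every $K\subseteq G$ with compact closure. For $l:S\to[0,\infty)$ and $L:G\to[0,\infty)$ put $$\Phi(l)([s,\xi])=\inf\{l(t):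 t\in S,\ \xi\in D_{t^*t},\ [t,\xi]=[s,\xi]\},\qquad \Psi(L)(s)=\sup_{\xi\in D_{s^*s}}L([s,\xi]).$$ Then the following hold. - If $l$ is a uniformly discrete length function on $S$, then $\Phi(l)$ is a uniformly discrete length function on $G$. For every length function $l$ on $S$, $\Phi(l)$ is controlled. The map $\Phi$ is injective on the set of length functions on $S$. - If $L:G\to[0,\infty)$ is controlled, then the suprema defining $\Psi(L)$ are finite. If $L$ is a controlled length function on $G$, then $\Psi(L)$ is a length function on $S$, and it is uniformly discrete if $L$ is. For every length function $l$ on $S$ one has $\Psi(\Phi(l))=l$. - A length function $l$ on $S$ is proper if and only if $\Phi(l)$ is proper. - If a length function $l$ on $S$ is tightly proper, then $\Phi(l)$ is proper and continuous. Conversely, if $l$ is a length function on $S$ whose set of values is a closed discrete subset of $[0,\infty)$ (that is, $l$ takes only finitely many values in each bounded interval), and $\Phi(l)$ is proper and continuous, then $l$ is tightly proper. -/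

import Mathlib

open scoped NNReal

/-- An inverse semigroup: every `s` has exactly one `s⁻¹` (written `s^*` in operator algebras)
with `s s⁻¹ s = s` and `s⁻¹ s s⁻¹ = s⁻¹`. -/
class InverseSemigroup (S : Type*) extends Semigroup S, Inv S where
  mul_inv_mul : ∀ s : S, s * s⁻¹ * s = s
  inv_mul_inv : ∀ s : S, s⁻¹ * s * s⁻¹ = s⁻¹
  inv_unique : ∀ s t : S, s * t * s = s → t * s * t = t → t = s⁻¹

namespace InverseSemigroup

variable {S : Type*} [InverseSemigroup S]

/-! ### Basic algebra -/

theorem inv_idem {e : S} (he : IsIdempotentElem e) : e⁻¹ = e := by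
  have h : e * e = e := he
  exact (inv_unique e e (by rw [h, h]) (by rw [h, h])).symm

theorem inv_inv' (s : S) : s⁻¹⁻¹ = s :=
  (inv_unique s⁻¹ s (inv_mul_inv s) (mul_inv_mul s)).symm

theorem idem_inv_mul (s : S) : IsIdempotentElem (s⁻¹ * s) := by
  change s⁻¹ * s * (s⁻¹ * s) = s⁻¹ * s
  rw [← mul_assoc, inv_mul_inv]

theorem idem_mul_inv (s : S) : IsIdempotentElem (s * s⁻¹) := by
  change s * s⁻¹ * (s * s⁻¹) = s * s⁻¹
  rw [← mul_assoc, mul_inv_mul]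

theorem idem_mul {e f : S} (he : IsIdempotentElem e) (hf : IsIdempotentElem f) :
    IsIdempotentElem (e * f) := by
  have he' : ∀ a, e * (e * a) = e * a := fun a => by rw [← mul_assoc, he.eq]
  have hf' : ∀ a, f * (f * a) = f * a := fun a => by rw [← mul_assoc, hf.eq]
  have h1 : ∀ a, e * (f * ((e * f)⁻¹ * (e * (f * a)))) = e * (f * a) := fun a => by
    have := congrArg (· * a) (mul_inv_mul (e * f))
    simpa only [mul_assoc] using this
  have h1' : e * (f * ((e * f)⁻¹ * (e * f))) = e * f := by
    simpa only [mul_assoc] using mul_inv_mul (e * f)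
  have h2 : ∀ a, (e * f)⁻¹ * (e * (f * ((e * f)⁻¹ * a))) = (e * f)⁻¹ * a := fun a => by
    have := congrArg (· * a) (inv_mul_inv (e * f))
    simpa only [mul_assoc] using this
  have hx : f * (e * f)⁻¹ * e = (e * f)⁻¹ := by
    apply inv_unique
    · simp only [mul_assoc, he', hf', h1']
    · simp only [mul_assoc, he', hf', h2]
  have hxi : IsIdempotentElem (e * f)⁻¹ := by
    change (e * f)⁻¹ * (e * f)⁻¹ = (e * f)⁻¹
    conv_lhs => rw [← hx]
    conv_rhs => rw [← hx]
    simp only [mul_assoc, h2]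
  have : e * f = (e * f)⁻¹ := by
    conv_lhs => rw [← inv_inv' (e * f)]
    exact inv_idem hxi
  rw [this]; exact hxi

theorem idem_comm {e f : S} (he : IsIdempotentElem e) (hf : IsIdempotentElem f) :
    e * f = f * e := by
  have he' : ∀ a, e * (e * a) = e * a := fun a => by rw [← mul_assoc, he.eq]
  have hf' : ∀ a, f * (f * a) = f * a := fun a => by rw [← mul_assoc, hf.eq]
  have h1 : e * (f * (e * f)) = e * f := by
    simpa only [mul_assoc] using (idem_mul he hf).eq
  have h2 : f * (e * (f * e)) = f * e := by
    simpa only [mul_assoc] using (idem_mul hf he).eq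
  have : f * e = (e * f)⁻¹ := by
    apply inv_unique
    · simp only [mul_assoc, he', hf', h1]
    · simp only [mul_assoc, he', hf', h2]
  rw [this, inv_idem (idem_mul he hf)]

theorem mul_inv_rev' (s t : S) : (s * t)⁻¹ = t⁻¹ * s⁻¹ := by
  have hc := idem_comm (idem_inv_mul s) (idem_mul_inv t)
  symm
  apply inv_unique
  · calc s * t * (t⁻¹ * s⁻¹) * (s * t) = s * ((t * t⁻¹) * (s⁻¹ * s)) * t := by
          simp only [mul_assoc]
      _ = (s * s⁻¹ * s) * (t * t⁻¹ * t) := by rw [← hc]; simp only [mul_assoc]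
      _ = s * t := by rw [mul_inv_mul, mul_inv_mul]
  · calc t⁻¹ * s⁻¹ * (s * t) * (t⁻¹ * s⁻¹) = t⁻¹ * ((s⁻¹ * s) * (t * t⁻¹)) * s⁻¹ := by
          simp only [mul_assoc]
      _ = (t⁻¹ * t * t⁻¹) * (s⁻¹ * s * s⁻¹) := by rw [hc]; simp only [mul_assoc]
      _ = t⁻¹ * s⁻¹ := by rw [inv_mul_inv, inv_mul_inv]

theorem conj_mul_conj (s : S) {f g : S} (hf : IsIdempotentElem f) :
    (s * f * s⁻¹) * (s * g * s⁻¹) = s * (f * g) * s⁻¹ := by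
  calc (s * f * s⁻¹) * (s * g * s⁻¹) = s * (f * (s⁻¹ * s)) * (g * s⁻¹) := by
        simp only [mul_assoc]
    _ = (s * s⁻¹ * s) * (f * g) * s⁻¹ := by
        rw [idem_comm hf (idem_inv_mul s)]; simp only [mul_assoc]
    _ = s * (f * g) * s⁻¹ := by rw [mul_inv_mul]

theorem idem_conj (s : S) {f : S} (hf : IsIdempotentElem f) :
    IsIdempotentElem (s * f * s⁻¹) := by
  change (s * f * s⁻¹) * (s * f * s⁻¹) = s * f * s⁻¹
  rw [conj_mul_conj s hf, hf.eq]

/-- The natural partial order: `s ≤ t` iff `s s⁻¹ t = s`. On idempotents it says `e f = e`. -/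
def NatLE (s t : S) : Prop := s * s⁻¹ * t = s

variable (S) in
/-- `S` is quasi-countable: some countable `X` generates `S`, as an inverse semigroup, together
with the idempotents, i.e. every inverse subsemigroup containing `X` and the idempotents is `S`. -/
def QuasiCountable : Prop :=
  ∃ X : Set S, X.Countable ∧
    ∀ T : Set S, X ⊆ T → (∀ e : S, IsIdempotentElem e → e ∈ T) →
      (∀ s ∈ T, ∀ t ∈ T, s * t ∈ T) → (∀ s ∈ T, s⁻¹ ∈ T) → T = Set.univ

/-! ### The spectrum of the semilattice of idempotents -/

variable (S) in
/-- A (nonempty) filter on the semilattice `E` of idempotents of `S`; the type of all of them is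
the spectrum `Ê₀` of `E`. -/
@[ext]
structure IdemFilter where
  carrier : Set S
  idem : ∀ e ∈ carrier, IsIdempotentElem e
  nonempty : carrier.Nonempty
  mul_mem : ∀ e ∈ carrier, ∀ f ∈ carrier, e * f ∈ carrier
  up : ∀ e ∈ carrier, ∀ f, IsIdempotentElem f → e * f = e → f ∈ carrier

instance : Membership S (IdemFilter S) := ⟨fun ξ e => e ∈ ξ.carrier⟩

/-- The topology on the spectrum with basis `D_e ∩ D_{e₁}ᶜ ∩ ⋯ ∩ D_{eₙ}ᶜ`, where
`e₁, …, eₙ < e` and `D_e = {ξ | e ∈ ξ}`. -/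
instance : TopologicalSpace (IdemFilter S) :=
  TopologicalSpace.generateFrom
    {U | ∃ (e : S) (F : Finset S), IsIdempotentElem e ∧
      (∀ f ∈ F, IsIdempotentElem f ∧ f * e = f ∧ f ≠ e) ∧
      U = {ξ | e ∈ ξ ∧ ∀ f ∈ F, f ∉ ξ}}

/-- `θ_s(ξ) = {e ∈ E | e ≥ s f s⁻¹ for some f ∈ ξ}`; restricted to the `ξ` with
`s⁻¹ s ∈ ξ` it is the partial homeomorphism `D_{s⁻¹s} → D_{ss⁻¹}`. -/
def theta (s : S) (ξ : IdemFilter S) : IdemFilter S where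
  carrier := {e | IsIdempotentElem e ∧ ∃ f ∈ ξ, (s * f * s⁻¹) * e = s * f * s⁻¹}
  idem := fun _ he => he.1
  nonempty := by
    obtain ⟨f, hf⟩ := ξ.nonempty
    exact ⟨s * f * s⁻¹, idem_conj s (ξ.idem f hf), f, hf, (idem_conj s (ξ.idem f hf)).eq⟩
  mul_mem := by
    rintro a ⟨ha, f, hf, hfa⟩ b ⟨hb, g, hg, hgb⟩
    have hfi := ξ.idem f hf
    have hgi := ξ.idem g hg
    refine ⟨idem_mul ha hb, f * g, ξ.mul_mem f hf g hg, ?_⟩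
    rw [← conj_mul_conj s hfi]
    calc s * f * s⁻¹ * (s * g * s⁻¹) * (a * b)
        = s * f * s⁻¹ * ((s * g * s⁻¹) * a) * b := by simp only [mul_assoc]
      _ = (s * f * s⁻¹ * a) * ((s * g * s⁻¹) * b) := by
          rw [idem_comm (idem_conj s hgi) ha]; simp only [mul_assoc]
      _ = s * f * s⁻¹ * (s * g * s⁻¹) := by rw [hfa, hgb]
  up := by
    rintro a ⟨_, f, hf, hfa⟩ b hb hab
    exact ⟨hb, f, hf, by rw [← hfa, mul_assoc, hab]⟩

theorem conj_mem_theta (s : S) {ξ : IdemFilter S} {f : S} (hf : f ∈ ξ) :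
    s * f * s⁻¹ ∈ theta s ξ :=
  ⟨idem_conj s (ξ.idem f hf), f, hf, (idem_conj s (ξ.idem f hf)).eq⟩

theorem mul_inv_mem_theta {s : S} {ξ : IdemFilter S} (h : s⁻¹ * s ∈ ξ) :
    s⁻¹⁻¹ * s⁻¹ ∈ theta s ξ := by
  rw [inv_inv']
  have := conj_mem_theta s h
  rwa [← mul_assoc, mul_inv_mul] at this

theorem theta_subset {s t e : S} {ξ : IdemFilter S} (he : e ∈ ξ) (h : s * e = t * e) :
    ∀ a ∈ theta s ξ, a ∈ theta t ξ := by
  rintro a ⟨ha, f, hf, hfa⟩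
  have hei := ξ.idem e he
  have hfi := ξ.idem f hf
  have key : s * (e * f) * s⁻¹ = t * (e * f) * t⁻¹ := by
    have hh : e * f = e * f * e := by
      rw [mul_assoc, idem_comm hfi hei, ← mul_assoc, hei.eq]
    have h2 : e * s⁻¹ = e * t⁻¹ := by
      have := congrArg (·⁻¹) h
      simpa only [mul_inv_rev', inv_idem hei] using this
    rw [hh]
    calc s * (e * f * e) * s⁻¹ = (s * e) * f * (e * s⁻¹) := by simp only [mul_assoc]
      _ = t * (e * f * e) * t⁻¹ := by rw [h, h2]; simp only [mul_assoc]
  refine ⟨ha, e * f, ξ.mul_mem e he f hf, ?_⟩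
  rw [← key, ← conj_mul_conj s hei, mul_assoc, hfa]

theorem theta_congr {s t e : S} {ξ : IdemFilter S} (he : e ∈ ξ) (h : s * e = t * e) :
    theta s ξ = theta t ξ := by
  ext a
  exact ⟨theta_subset he h a, theta_subset he h.symm a⟩

/-! ### The universal groupoid -/

variable (S) in
/-- Pairs `(s, ξ)` with `ξ ∈ D_{s⁻¹s}`. -/
structure PreGerm where
  elt : S
  pt : IdemFilter S
  mem : elt⁻¹ * elt ∈ pt

variable (S) in
/-- `(s, ξ) ∼ (t, ζ)` iff `ξ = ζ` and `s e = t e` for some idempotent `e ∈ ξ`. -/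
instance germSetoid : Setoid (PreGerm S) where
  r p q := p.pt = q.pt ∧ ∃ e ∈ p.pt, p.elt * e = q.elt * e
  iseqv :=
    { refl := fun p => ⟨rfl, _, p.mem, rfl⟩
      symm := by
        rintro p q ⟨h, e, he, h'⟩
        exact ⟨h.symm, e, h ▸ he, h'.symm⟩
      trans := by
        rintro p q r ⟨h, e, he, h'⟩ ⟨k, f, hf, k'⟩
        have hf' : f ∈ p.pt := h ▸ hf
        refine ⟨h.trans k, e * f, p.pt.mul_mem e he f hf', ?_⟩
        calc p.elt * (e * f) = q.elt * (e * f) := by rw [← mul_assoc, h', mul_assoc]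
          _ = q.elt * f * e := by
              rw [idem_comm (p.pt.idem e he) (p.pt.idem f hf'), mul_assoc]
          _ = r.elt * (e * f) := by
              rw [k', idem_comm (p.pt.idem e he) (p.pt.idem f hf'), mul_assoc] }

variable (S) in
/-- The universal groupoid of `S`: the groupoid of germs of the action `θ` on the spectrum. -/
def UnivGroupoid : Type _ := Quotient (germSetoid S)

/-- The germ `[s, ξ]`, for `ξ ∈ D_{s⁻¹s}`. -/
def germ (s : S) (ξ : IdemFilter S) (h : s⁻¹ * s ∈ ξ) : UnivGroupoid S :=
  Quotient.mk (germSetoid S) ⟨s, ξ, h⟩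

/-- The topology of germs, with basis the sets `{[s, ξ] | ξ ∈ U}` for `s ∈ S` and `U ⊆ D_{s⁻¹s}`
open in the spectrum. -/
instance : TopologicalSpace (UnivGroupoid S) :=
  TopologicalSpace.generateFrom
    {V | ∃ (s : S) (U : Set (IdemFilter S)) (hU : ∀ ξ ∈ U, s⁻¹ * s ∈ ξ), IsOpen U ∧
      V = {g | ∃ (ξ : IdemFilter S) (h : ξ ∈ U), g = germ s ξ (hU ξ h)}}

namespace UnivGroupoid

/-- The unit space `G⁽⁰⁾`: the germs of idempotents. -/
def units : Set (UnivGroupoid S) :=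
  {g | ∃ (e : S) (ξ : IdemFilter S) (h : e⁻¹ * e ∈ ξ), IsIdempotentElem e ∧ g = germ e ξ h}

/-- The source `s([s, ξ]) = ξ`. -/
def source (g : UnivGroupoid S) : IdemFilter S :=
  Quotient.lift (fun p : PreGerm S => p.pt) (by rintro p q ⟨h, -⟩; exact h) g

/-- The range `r([s, ξ]) = θ_s(ξ)`. -/
def range (g : UnivGroupoid S) : IdemFilter S :=
  Quotient.lift (fun p : PreGerm S => theta p.elt p.pt)
    (by
      rintro p q ⟨h, e, he, h'⟩
      rw [← h]
      exact theta_congr he h') g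

/-- The inverse `[s, ξ]⁻¹ = [s⁻¹, θ_s(ξ)]`. -/
instance : Inv (UnivGroupoid S) where
  inv := Quotient.lift
    (fun p : PreGerm S => germ p.elt⁻¹ (theta p.elt p.pt) (mul_inv_mem_theta p.mem))
    (by
      rintro p q ⟨h, e, he, h'⟩
      have hei := p.pt.idem e he
      refine Quotient.sound (s := germSetoid S)
        ⟨?_, p.elt * e * p.elt⁻¹, conj_mem_theta _ he, ?_⟩
      · change theta p.elt p.pt = theta q.elt q.pt
        rw [← h]
        exact theta_congr he h'
      · change p.elt⁻¹ * (p.elt * e * p.elt⁻¹) = q.elt⁻¹ * (p.elt * e * p.elt⁻¹)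
        have h2 : e * p.elt⁻¹ = e * q.elt⁻¹ := by
          have := congrArg (·⁻¹) h'
          simpa only [mul_inv_rev', inv_idem hei] using this
        have h3 : ∀ s : S, s⁻¹ * (s * e * s⁻¹) = e * s⁻¹ := fun s => by
          calc s⁻¹ * (s * e * s⁻¹) = (s⁻¹ * s) * e * s⁻¹ := by simp only [mul_assoc]
            _ = e * (s⁻¹ * s * s⁻¹) := by
                rw [idem_comm (idem_inv_mul s) hei]; simp only [mul_assoc]
            _ = e * s⁻¹ := by rw [inv_mul_inv]
        have h4 : p.elt * e * p.elt⁻¹ = q.elt * e * q.elt⁻¹ := by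
          rw [mul_assoc, h2, ← mul_assoc, h']
        rw [h3, h4, h3, h2])

theorem mul_aux {s t : S} {ξ : IdemFilter S} (ht : t⁻¹ * t ∈ ξ)
    (hs : s⁻¹ * s ∈ theta t ξ) : (s * t)⁻¹ * (s * t) ∈ ξ := by
  obtain ⟨-, f, hf, h⟩ := hs
  have hfi := ξ.idem f hf
  refine ξ.up _ (ξ.mul_mem _ ht f hf) _ (idem_inv_mul _) ?_
  rw [mul_inv_rev']
  calc t⁻¹ * t * f * (t⁻¹ * s⁻¹ * (s * t))
      = t⁻¹ * ((t * f * t⁻¹) * (s⁻¹ * s)) * t := by simp only [mul_assoc]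
    _ = t⁻¹ * t * (f * (t⁻¹ * t)) := by rw [h]; simp only [mul_assoc]
    _ = t⁻¹ * t * f := by
        rw [idem_comm hfi (idem_inv_mul t), ← mul_assoc, (idem_inv_mul t).eq]

open Classical in
/-- The product of composable arrows (those with `s(g) = r(h)`):
`[s, θ_t(ξ)] [t, ξ] = [s t, ξ]`. It has the meaningless value `h` on the other pairs. -/
noncomputable instance : Mul (UnivGroupoid S) where
  mul := Quotient.lift₂
    (fun p q : PreGerm S =>
      if hc : p.pt = theta q.elt q.pt then
        germ (p.elt * q.elt) q.pt (mul_aux q.mem (hc ▸ p.mem))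
      else germ q.elt q.pt q.mem)
    (by
      rintro p q p' q' ⟨hp, e, he, hpe⟩ ⟨hq, f, hf, hqf⟩
      have hth : theta q.elt q.pt = theta q'.elt q'.pt := by
        rw [← hq]; exact theta_congr hf hqf
      by_cases hc : p.pt = theta q.elt q.pt
      · have hc' : p'.pt = theta q'.elt q'.pt := by rw [← hp, hc, hth]
        refine (dif_pos hc).trans (Eq.trans ?_ (dif_pos hc').symm)
        rw [hc] at he
        obtain ⟨hei, g, hg, hge⟩ := he
        have hgi := q.pt.idem g hg
        have hfi := q.pt.idem f hf
        refine Quotient.sound (s := germSetoid S) ⟨hq, g * f, q.pt.mul_mem g hg f hf, ?_⟩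
        change p.elt * q.elt * (g * f) = p'.elt * q'.elt * (g * f)
        generalize p.elt = s at *
        generalize p'.elt = s' at *
        generalize q.elt = t at *
        generalize q'.elt = t' at *
        have htg : t * g = t * g * t⁻¹ * t := by
          calc t * g = (t * t⁻¹ * t) * g := by rw [mul_inv_mul]
            _ = t * ((t⁻¹ * t) * g) := by simp only [mul_assoc]
            _ = t * g * t⁻¹ * t := by
                rw [idem_comm (idem_inv_mul t) hgi]; simp only [mul_assoc]
        have k : e * (t * g) = t * g := by
          rw [htg, ← mul_assoc, idem_comm hei (idem_conj t hgi), hge]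
        calc s * t * (g * f) = s * (t * g) * f := by simp only [mul_assoc]
          _ = s * e * (t * g) * f := by rw [← k]; simp only [mul_assoc, ← mul_assoc e e, hei.eq]
          _ = s' * (e * (t * g)) * f := by rw [hpe]; simp only [mul_assoc]
          _ = s' * (t * (g * f)) := by rw [k]; simp only [mul_assoc]
          _ = s' * (t * f * g) := by rw [idem_comm hgi hfi, mul_assoc]
          _ = s' * t' * (g * f) := by rw [hqf, idem_comm hgi hfi]; simp only [mul_assoc]
      · have hc' : ¬ p'.pt = theta q'.elt q'.pt := by rw [← hp, ← hth]; exact hc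
        refine (dif_neg hc).trans (Eq.trans ?_ (dif_neg hc').symm)
        exact Quotient.sound (s := germSetoid S) ⟨hq, f, hf, hqf⟩)

theorem germ_mul_germ (s t : S) (ξ : IdemFilter S) (ht : t⁻¹ * t ∈ ξ)
    (hs : s⁻¹ * s ∈ theta t ξ) :
    germ s (theta t ξ) hs * germ t ξ ht = germ (s * t) ξ (mul_aux ht hs) :=
  dif_pos rfl

/-- A length function on the groupoid. -/
structure IsLength (L : UnivGroupoid S → ℝ≥0) : Prop where
  eq_zero_iff : ∀ g, L g = 0 ↔ g ∈ units
  inv : ∀ g, L g⁻¹ = L g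
  mul_le : ∀ g h, g.source = h.range → L (g * h) ≤ L g + L h

/-- Sets of non-units on which `L` is bounded are precompact. -/
def Proper (L : UnivGroupoid S → ℝ≥0) : Prop :=
  ∀ K : Set (UnivGroupoid S), K ⊆ unitsᶜ → BddAbove (L '' K) → IsCompact (closure K)

/-- `L` is bounded on precompact sets. -/
def Controlled (L : UnivGroupoid S → ℝ≥0) : Prop :=
  ∀ K : Set (UnivGroupoid S), IsCompact (closure K) → BddAbove (L '' K)

/-- The values of `L` on non-units are bounded away from `0`. -/
def UniformlyDiscrete (L : UnivGroupoid S → ℝ≥0) : Prop :=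
  ∃ c > 0, ∀ g, g ∉ units → c ≤ L g

end UnivGroupoid

/-! ### Length functions on the inverse semigroup -/

/-- A length function on the inverse semigroup. -/
structure IsLength (l : S → ℝ≥0) : Prop where
  eq_zero_iff : ∀ s, l s = 0 ↔ IsIdempotentElem s
  inv : ∀ s, l s⁻¹ = l s
  mul_le : ∀ s t, l (s * t) ≤ l s + l t

/-- The values of `l` on non-idempotents are bounded away from `0`; equivalently, the extended
metric `d(s, t) = l(t s⁻¹)` (if `s⁻¹s = t⁻¹t`; `∞` otherwise) is uniformly discrete. -/
def UniformlyDiscrete (l : S → ℝ≥0) : Prop :=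
  ∃ c > 0, ∀ s, ¬ IsIdempotentElem s → c ≤ l s

/-- The values of `l` form a closed discrete subset of `[0, ∞)`. -/
def DiscreteValues (l : S → ℝ≥0) : Prop :=
  ∀ r : ℝ≥0, (Set.range l ∩ Set.Iic r).Finite

/-- The finite set `F` witnesses `r`-properness of `l`: each element of the cylinder
`{s | 0 < l(s) ≤ r}` lies below an element of `F`. -/
def Witnesses (l : S → ℝ≥0) (r : ℝ≥0) (F : Finset S) : Prop :=
  ∀ s, 0 < l s → l s ≤ r → ∃ m ∈ F, NatLE s m

/-- `l` is proper. -/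
def Proper (l : S → ℝ≥0) : Prop :=
  ∀ r : ℝ≥0, ∃ F : Finset S, Witnesses l r F

/-- `l` is tightly proper. -/
def TightlyProper (l : S → ℝ≥0) : Prop :=
  ∀ r : ℝ≥0, ∃ F : Finset S, Witnesses l r F ∧ ∀ m ∈ F, l m ≤ r

/-! ### The maps between the two kinds of length functions -/

/-- `Φ(l)([s, ξ]) = inf {l(t) | t ∈ S, ξ ∈ D_{t⁻¹t}, [t, ξ] = [s, ξ]}`. -/
noncomputable def Phi (l : S → ℝ≥0) (g : UnivGroupoid S) : ℝ≥0 :=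
  sInf {r | ∃ (t : S) (h : t⁻¹ * t ∈ g.source), germ t g.source h = g ∧ r = l t}

/-- `Ψ(L)(s) = sup_{ξ ∈ D_{s⁻¹s}} L([s, ξ])`. -/
noncomputable def Psi (L : UnivGroupoid S → ℝ≥0) (s : S) : ℝ≥0 :=
  ⨆ ξ : {ξ : IdemFilter S // s⁻¹ * s ∈ ξ}, L (germ s ξ.1 ξ.2)

end InverseSemigroup

/-!
For `s ∈ S` let `B_s ⊆ G` be the set of the germs `[s, ξ]`. Then `Φ(l)(g) = inf {l(t) | g ∈ B_t}`
and `Ψ(L)(s) = sup {L(g) | g ∈ B_s}`, and the sets `B_s` carry the algebra of `S` over to `G`: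
`B_s⁻¹ = B_{s⁻¹}`, `B_s B_t = B_{st}`, and `G⁽⁰⁾` is the union of the `B_e` with `e` idempotent.
Moreover the germ of `s` at the principal filter of `s⁻¹s` lies in `B_t` exactly when `s ≤ t`, so
its value under `Φ(l)` is `l(s)`. This gives `Ψ(Φ(l)) = l`, and it shows that a finite set `F`
witnesses `r`-properness of `l` as soon as the `B_m` with `m ∈ F` cover the non-units with
`Φ(l) ≤ r`; conversely they cover these if `F` witnesses `r'`-properness for some `r' > r`.

The `B_s` are open and compact, hence closed when `G` is Hausdorff, and `G⁽⁰⁾` is then closed as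
well. Always `Φ(l)` is upper semicontinuous. If `l` is tightly proper with witnesses `F_r`, the
set `{Φ(l) ≤ r}` is the union of `G⁽⁰⁾` and the intersection over `r' > r` of the finite unions of
the `B_m` with `m ∈ F_{r'}`, so it is closed, and `Φ(l)` is continuous. Conversely, if the values
of `l` are discrete, the infimum defining `Φ(l)` is attained, so the set of the non-units with
`Φ(l) ≤ r`, which is compact if `Φ(l)` is proper and continuous, is covered by the `B_t` with
`l(t) ≤ r`.
-/

namespace InverseSemigroup

open Set Topology

variable {S : Type*} [InverseSemigroup S]

/-! ### Conjugation of idempotents and the natural order -/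

theorem inv_mul_self_of_idem {e : S} (he : IsIdempotentElem e) : e⁻¹ * e = e := by
  rw [inv_idem he, he.eq]

theorem inv_mul_self_mul (s t : S) : (s * t)⁻¹ * (s * t) = t⁻¹ * (s⁻¹ * s) * t := by
  rw [mul_inv_rev']
  simp only [mul_assoc]

theorem mul_inv_conj (s : S) {e : S} (he : IsIdempotentElem e) : s * (s⁻¹ * e * s) = e * s := by
  calc s * (s⁻¹ * e * s) = s * s⁻¹ * e * s := by simp only [mul_assoc]
    _ = e * (s * s⁻¹ * s) := by rw [idem_comm (idem_mul_inv s) he, mul_assoc]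
    _ = e * s := by rw [mul_inv_mul]

theorem inv_conj_conj (s : S) {e : S} (he : IsIdempotentElem e) :
    s⁻¹ * (s * e * s⁻¹) * s = e * (s⁻¹ * s) := by
  have h := mul_inv_conj s⁻¹ he
  rw [inv_inv'] at h
  rw [h, mul_assoc]

theorem idem_inv_conj (s : S) {e : S} (he : IsIdempotentElem e) :
    IsIdempotentElem (s⁻¹ * e * s) := by
  simpa only [inv_inv'] using idem_conj s⁻¹ he

theorem natLE_mul_idem (t : S) {e : S} (he : IsIdempotentElem e) : NatLE (t * e) t :=
  calc t * e * (t * e)⁻¹ * t = t * (e * e * (t⁻¹ * t)) := by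
        rw [mul_inv_rev', inv_idem he]; simp only [mul_assoc]
    _ = t * (t⁻¹ * t * e) := by rw [he.eq, idem_comm he (idem_inv_mul t)]
    _ = t * e := by rw [← mul_assoc, ← mul_assoc, mul_inv_mul]

theorem NatLE.mul_inv_mul_eq {s t : S} (h : NatLE s t) : t * (s⁻¹ * s) = s := by
  have hs : s * s⁻¹ * t = s := h
  have hinv : s⁻¹ * s = t⁻¹ * (s * s⁻¹) * t := by
    calc s⁻¹ * s = (s * s⁻¹ * t)⁻¹ * (s * s⁻¹ * t) := by rw [hs]
      _ = t⁻¹ * (s * s⁻¹) * t := by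
        rw [inv_mul_self_mul, inv_mul_self_of_idem (idem_mul_inv s)]
  rw [hinv, mul_inv_conj t (idem_mul_inv s), hs]

theorem NatLE.inv_mul_mul_inv_mul {s t : S} (h : NatLE s t) :
    s⁻¹ * s * (t⁻¹ * t) = s⁻¹ * s := by
  have hst : s * (t⁻¹ * t) = s := by
    calc s * (t⁻¹ * t) = t * (s⁻¹ * s * (t⁻¹ * t)) := by rw [← mul_assoc t, h.mul_inv_mul_eq]
      _ = t * t⁻¹ * t * (s⁻¹ * s) := by
        rw [idem_comm (idem_inv_mul s) (idem_inv_mul t)]; simp only [mul_assoc]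
      _ = s := by rw [mul_inv_mul, h.mul_inv_mul_eq]
  rw [mul_assoc, hst]

theorem NatLE.isIdempotentElem {s e : S} (h : NatLE s e) (he : IsIdempotentElem e) :
    IsIdempotentElem s := by
  rw [← h.mul_inv_mul_eq]
  exact idem_mul he (idem_inv_mul s)

/-! ### Filters of idempotents -/

theorem IdemFilter.mul_mem_iff {ξ : IdemFilter S} {e f : S} (he : IsIdempotentElem e)
    (hf : IsIdempotentElem f) : e * f ∈ ξ ↔ e ∈ ξ ∧ f ∈ ξ := by
  refine ⟨fun h => ⟨ξ.up _ h e he ?_, ξ.up _ h f hf ?_⟩, fun h => ξ.mul_mem e h.1 f h.2⟩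
  · rw [idem_comm he hf, mul_assoc, he.eq]
  · rw [mul_assoc, hf.eq]

theorem mem_theta_iff {s e : S} {ξ : IdemFilter S} (hs : s⁻¹ * s ∈ ξ) (he : IsIdempotentElem e) :
    e ∈ theta s ξ ↔ s⁻¹ * e * s ∈ ξ := by
  constructor
  · rintro ⟨-, f, hf, hfe⟩
    have hfi := ξ.idem f hf
    refine ξ.up _ (ξ.mul_mem f hf _ hs) _ (idem_inv_conj s he) ?_
    have hconj := conj_mul_conj s⁻¹ (g := e) (idem_conj s hfi)
    rwa [hfe, inv_inv', inv_conj_conj s hfi] at hconj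
  · refine fun h => ⟨he, _, h, ?_⟩
    calc s * (s⁻¹ * e * s) * s⁻¹ * e = e * (s * s⁻¹ * e) := by
          rw [mul_inv_conj s he]; simp only [mul_assoc]
      _ = e * e * (s * s⁻¹) := by rw [idem_comm (idem_mul_inv s) he, mul_assoc]
      _ = s * (s⁻¹ * e * s) * s⁻¹ := by rw [he.eq, mul_inv_conj s he, mul_assoc]

theorem theta_inv_theta {s : S} {ξ : IdemFilter S} (hs : s⁻¹ * s ∈ ξ) :
    theta s⁻¹ (theta s ξ) = ξ := by
  have h (e : S) (he : IsIdempotentElem e) : e ∈ theta s⁻¹ (theta s ξ) ↔ e ∈ ξ := by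
    rw [mem_theta_iff (mul_inv_mem_theta hs) he, inv_inv', mem_theta_iff hs (idem_conj s he),
      inv_conj_conj s he, IdemFilter.mul_mem_iff he (idem_inv_mul s), and_iff_left hs]
  ext e
  exact ⟨fun he => (h e he.1).1 he, fun he => (h e (ξ.idem e he)).2 he⟩

theorem inv_mul_self_mul_mem_iff {s t : S} {ξ : IdemFilter S} :
    (s * t)⁻¹ * (s * t) ∈ ξ ↔ t⁻¹ * t ∈ ξ ∧ s⁻¹ * s ∈ theta t ξ := by
  refine ⟨fun h => ?_, fun h => UnivGroupoid.mul_aux h.1 h.2⟩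
  rw [inv_mul_self_mul] at h
  have ht : t⁻¹ * t ∈ ξ :=
    ξ.up _ h _ (idem_inv_mul t) (by rw [mul_assoc, ← mul_assoc t, mul_inv_mul])
  exact ⟨ht, (mem_theta_iff ht (idem_inv_mul s)).2 h⟩

theorem NatLE.inv_mul_mem {s t : S} (h : NatLE s t) {ξ : IdemFilter S} (hs : s⁻¹ * s ∈ ξ) :
    t⁻¹ * t ∈ ξ :=
  ξ.up _ hs _ (idem_inv_mul t) h.inv_mul_mul_inv_mul

/-- The principal filter of the idempotents above `e`, which is the smallest filter
containing `e`. -/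
def principal (e : S) (he : IsIdempotentElem e) : IdemFilter S where
  carrier := {f | IsIdempotentElem f ∧ e * f = e}
  idem := fun _ hf => hf.1
  nonempty := ⟨e, he, he⟩
  mul_mem := by
    rintro f ⟨hf, hef⟩ g ⟨hg, heg⟩
    exact ⟨idem_mul hf hg, by rw [← mul_assoc, hef, heg]⟩
  up := by
    rintro f ⟨-, hef⟩ g hg hfg
    exact ⟨hg, by rw [← hef, mul_assoc, hfg]⟩

theorem self_mem_principal {e : S} (he : IsIdempotentElem e) : e ∈ principal e he := ⟨he, he⟩

/-! ### Germs and bisections -/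

theorem germ_eq_germ_iff {s t : S} {ξ : IdemFilter S} (hs : s⁻¹ * s ∈ ξ) (ht : t⁻¹ * t ∈ ξ) :
    germ s ξ hs = germ t ξ ht ↔ ∃ e ∈ ξ, s * e = t * e :=
  ⟨fun h => (Quotient.exact (s := germSetoid S) h).2,
    fun h => Quotient.sound (s := germSetoid S) ⟨rfl, h⟩⟩

theorem germ_congr {s t : S} {ξ ζ : IdemFilter S} (hs : s⁻¹ * s ∈ ξ) (hst : s = t)
    (hξ : ξ = ζ) : germ s ξ hs = germ t ζ (hst ▸ hξ ▸ hs) := by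
  subst hst hξ; rfl

theorem germ_idem_eq_germ_idem {e f : S} {ξ : IdemFilter S} (he : IsIdempotentElem e)
    (hf : IsIdempotentElem f) (heξ : e⁻¹ * e ∈ ξ) (hfξ : f⁻¹ * f ∈ ξ) :
    germ e ξ heξ = germ f ξ hfξ := by
  refine (germ_eq_germ_iff heξ hfξ).2 ⟨e * f, ?_, ?_⟩
  · rw [inv_mul_self_of_idem he] at heξ
    rw [inv_mul_self_of_idem hf] at hfξ
    exact ξ.mul_mem e heξ f hfξ
  · rw [← mul_assoc, he.eq, idem_comm he hf, ← mul_assoc, hf.eq]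

/-- The map `ξ ↦ [s, ξ]` on `D_{s⁻¹s}`. -/
def germMap (s : S) (ξ : {ξ : IdemFilter S // s⁻¹ * s ∈ ξ}) : UnivGroupoid S :=
  germ s ξ.1 ξ.2

/-- The bisection `{[s, ξ] | ξ ∈ D_{s⁻¹s}}` of the universal groupoid, on which the source map
is injective. -/
def bisection (s : S) : Set (UnivGroupoid S) := range (germMap s)

theorem germ_mem_bisection {s : S} {ξ : IdemFilter S} (h : s⁻¹ * s ∈ ξ) :
    germ s ξ h ∈ bisection s :=
  ⟨⟨ξ, h⟩, rfl⟩

theorem exists_mem_bisection (g : UnivGroupoid S) : ∃ s, g ∈ bisection s := by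
  induction g using Quotient.inductionOn with
  | h p => exact ⟨p.elt, germ_mem_bisection p.mem⟩

theorem mem_units_iff_exists_bisection {g : UnivGroupoid S} :
    g ∈ UnivGroupoid.units ↔ ∃ e, IsIdempotentElem e ∧ g ∈ bisection e := by
  constructor
  · rintro ⟨e, ξ, h, he, rfl⟩
    exact ⟨e, he, germ_mem_bisection h⟩
  · rintro ⟨e, he, ξ, rfl⟩
    exact ⟨e, ξ.1, ξ.2, he, rfl⟩

theorem mem_units_iff_eq_germ {s : S} {ξ : IdemFilter S} (h : s⁻¹ * s ∈ ξ) :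
    germ s ξ h ∈ UnivGroupoid.units ↔
      germ s ξ h = germ (s⁻¹ * s) ξ (by rwa [inv_mul_self_of_idem (idem_inv_mul s)]) := by
  refine ⟨?_, fun heq => ⟨_, _, _, idem_inv_mul s, heq⟩⟩
  rintro ⟨e, ζ, he, hei, heq⟩
  obtain rfl : ξ = ζ := congrArg UnivGroupoid.source heq
  rw [heq]
  exact germ_idem_eq_germ_idem hei (idem_inv_mul s) _ _

theorem UnivGroupoid.inv_inv (g : UnivGroupoid S) : g⁻¹⁻¹ = g := by
  obtain ⟨s, ξ, rfl⟩ := exists_mem_bisection g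
  exact germ_congr _ (inv_inv' s) (theta_inv_theta ξ.2)

theorem inv_mem_bisection_inv {s : S} {g : UnivGroupoid S} (hg : g ∈ bisection s) :
    g⁻¹ ∈ bisection s⁻¹ := by
  obtain ⟨ξ, rfl⟩ := hg
  exact germ_mem_bisection (mul_inv_mem_theta ξ.2)

theorem mem_bisection_mul_iff {s t : S} {k : UnivGroupoid S} :
    k ∈ bisection (s * t) ↔
      ∃ g ∈ bisection s, ∃ h ∈ bisection t, g.source = h.range ∧ g * h = k := by
  constructor
  · rintro ⟨ξ, rfl⟩
    obtain ⟨ht, hs⟩ := inv_mul_self_mul_mem_iff.1 ξ.2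
    exact ⟨_, germ_mem_bisection hs, _, germ_mem_bisection ht, rfl,
      UnivGroupoid.germ_mul_germ s t ξ.1 ht hs⟩
  · rintro ⟨_, ⟨⟨ξ, hs⟩, rfl⟩, _, ⟨⟨ζ, ht⟩, rfl⟩, hξ, rfl⟩
    obtain rfl : ξ = theta t ζ := hξ
    exact (UnivGroupoid.germ_mul_germ s t ζ ht hs).symm ▸ germ_mem_bisection _

theorem NatLE.bisection_subset {s t : S} (h : NatLE s t) : bisection s ⊆ bisection t := by
  rintro _ ⟨⟨ξ, hs⟩, rfl⟩
  refine ⟨⟨ξ, h.inv_mul_mem hs⟩, (germ_eq_germ_iff _ _).2 ⟨_, hs, ?_⟩⟩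
  rw [h.mul_inv_mul_eq, ← mul_assoc, mul_inv_mul]

/-- The germ of `s` at the principal filter of `s⁻¹ s`, which detects the elements above `s`. -/
def principalGerm (s : S) : UnivGroupoid S :=
  germ s (principal (s⁻¹ * s) (idem_inv_mul s)) (self_mem_principal _)

theorem principalGerm_mem_bisection (s : S) : principalGerm s ∈ bisection s :=
  germ_mem_bisection _

theorem principalGerm_mem_bisection_iff {s t : S} :
    principalGerm s ∈ bisection t ↔ NatLE s t := by
  refine ⟨?_, fun h => h.bisection_subset (principalGerm_mem_bisection s)⟩
  rintro ⟨⟨ξ, ht⟩, heq⟩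
  obtain rfl : principal (s⁻¹ * s) (idem_inv_mul s) = ξ :=
    (congrArg UnivGroupoid.source heq).symm
  obtain ⟨e, ⟨hei, he⟩, hse⟩ := (germ_eq_germ_iff _ _).1 heq
  have hs : t * (s⁻¹ * s) = s := by
    calc t * (s⁻¹ * s) = t * e * (s⁻¹ * s) := by
          rw [mul_assoc, idem_comm hei (idem_inv_mul s), he]
      _ = s * (s⁻¹ * s) := by
          rw [hse, mul_assoc, idem_comm hei (idem_inv_mul s), he]
      _ = s := by rw [← mul_assoc, mul_inv_mul]
  exact hs ▸ natLE_mul_idem t (idem_inv_mul s)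

theorem principalGerm_mem_units_iff {s : S} :
    principalGerm s ∈ UnivGroupoid.units ↔ IsIdempotentElem s := by
  simp only [mem_units_iff_exists_bisection, principalGerm_mem_bisection_iff]
  exact ⟨fun ⟨_, he, hse⟩ => hse.isIdempotentElem he,
    fun hs => ⟨s, hs, principalGerm_mem_bisection_iff.1 (principalGerm_mem_bisection s)⟩⟩

/-! ### The topologies of the spectrum and of the universal groupoid -/

theorem isOpen_setOf_mem (e : S) : IsOpen {ξ : IdemFilter S | e ∈ ξ} := by
  by_cases he : IsIdempotentElem e
  · exact TopologicalSpace.isOpen_generateFrom_of_mem ⟨e, ∅, he, by simp, by simp⟩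
  · convert isOpen_empty
    exact eq_empty_of_forall_notMem fun ξ h => he (ξ.idem e h)

theorem le_nhds_of_eventually_mem_iff {U : Filter (IdemFilter S)} {ξ : IdemFilter S}
    (h : ∀ e, ∀ᶠ η in U, e ∈ η ↔ e ∈ ξ) : U ≤ 𝓝 ξ := by
  rw [TopologicalSpace.nhds_generateFrom]
  refine le_iInf₂ fun V hV => ?_
  obtain ⟨hξ, e, F, -, -, rfl⟩ := hV
  rw [Filter.le_principal_iff]
  filter_upwards [h e, (Filter.eventually_all_finset F).2 fun f _ => h f] with η he hF
  exact ⟨he.2 hξ.1, fun f hf => mt (hF f hf).1 (hξ.2 f hf)⟩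

/-- The filter of the idempotents that eventually belong to `η` as `η` runs along `U`; if `U` is
an ultrafilter, this is its limit in the spectrum. -/
def eventualFilter (U : Filter (IdemFilter S)) [U.NeBot] {e : S} (he : ∀ᶠ η in U, e ∈ η) :
    IdemFilter S where
  carrier := {a | ∀ᶠ η in U, a ∈ η}
  idem := fun a ha => (Filter.Eventually.exists ha).elim fun η hη => η.idem a hη
  nonempty := ⟨e, he⟩
  mul_mem := fun a ha b hb => (Filter.Eventually.and ha hb).mono fun η h => η.mul_mem a h.1 b h.2
  up := fun a ha b hb hab => Filter.Eventually.mono ha fun η h => η.up a h b hb hab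

theorem isCompact_setOf_mem (e : S) : IsCompact {ξ : IdemFilter S | e ∈ ξ} := by
  rw [isCompact_iff_ultrafilter_le_nhds]
  intro U hU
  have he : ∀ᶠ η in (U : Filter (IdemFilter S)), e ∈ η := Filter.le_principal_iff.1 hU
  refine ⟨eventualFilter U he, he, le_nhds_of_eventually_mem_iff fun a => ?_⟩
  by_cases ha : ∀ᶠ η in (U : Filter (IdemFilter S)), a ∈ η
  · exact ha.mono fun η hη => iff_of_true hη ha
  · exact (Ultrafilter.eventually_not.2 ha).mono fun η hη => iff_of_false hη ha

theorem isOpenMap_germMap (s : S) : IsOpenMap (germMap s) := by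
  rintro _ ⟨V, hV, rfl⟩
  refine TopologicalSpace.isOpen_generateFrom_of_mem
    ⟨s, V ∩ {ξ | s⁻¹ * s ∈ ξ}, fun ξ h => h.2, hV.inter (isOpen_setOf_mem _), ?_⟩
  ext g
  constructor
  · rintro ⟨⟨ξ, h⟩, hξ, rfl⟩
    exact ⟨ξ, ⟨hξ, h⟩, rfl⟩
  · rintro ⟨ξ, ⟨hξ, h⟩, rfl⟩
    exact ⟨⟨ξ, h⟩, hξ, rfl⟩

theorem continuous_germMap (s : S) : Continuous (germMap s) := by
  refine continuous_generateFrom_iff.2 ?_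
  rintro _ ⟨t, U, hU, hUo, rfl⟩
  rw [isOpen_iff_mem_nhds]
  rintro ⟨ξ, hs⟩ ⟨ζ, hζ, heq⟩
  obtain rfl : ξ = ζ := congrArg UnivGroupoid.source heq
  obtain ⟨e, he, hse⟩ := (germ_eq_germ_iff _ _).1 heq
  have ho := (hUo.inter (isOpen_setOf_mem e)).preimage
    (continuous_subtype_val (p := fun ξ : IdemFilter S => s⁻¹ * s ∈ ξ))
  filter_upwards [ho.mem_nhds ⟨hζ, he⟩] with η ⟨hηU, hηe⟩
  exact ⟨η, hηU, (germ_eq_germ_iff _ _).2 ⟨e, hηe, hse⟩⟩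

theorem isOpen_of_preimage_germMap {V : Set (UnivGroupoid S)}
    (h : ∀ s, IsOpen (germMap s ⁻¹' V)) : IsOpen V := by
  have hV : V = ⋃ s, germMap s '' (germMap s ⁻¹' V) := by
    simp only [image_preimage_eq_inter_range, ← inter_iUnion]
    exact (inter_eq_left.2 fun g _ => mem_iUnion.2 (exists_mem_bisection g)).symm
  rw [hV]
  exact isOpen_iUnion fun s => isOpenMap_germMap s _ (h s)

theorem isOpen_bisection (s : S) : IsOpen (bisection s) :=
  (isOpenMap_germMap s).isOpen_range

theorem isCompact_bisection (s : S) : IsCompact (bisection s) := by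
  have : CompactSpace {ξ : IdemFilter S // s⁻¹ * s ∈ ξ} :=
    isCompact_iff_compactSpace.1 (isCompact_setOf_mem (s⁻¹ * s))
  exact isCompact_range (continuous_germMap s)

theorem exists_finset_bisection_cover {K : Set (UnivGroupoid S)} (hK : IsCompact K) {T : Set S}
    (hT : ∀ g ∈ K, ∃ s ∈ T, g ∈ bisection s) :
    ∃ F : Finset S, ↑F ⊆ T ∧ K ⊆ ⋃ s ∈ F, bisection s := by
  obtain ⟨F, hFT, hF, hKF⟩ := hK.elim_finite_subcover_image (b := T)
    (fun s _ => isOpen_bisection s) fun g hg => mem_iUnion₂.2 <| by simpa using hT g hg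
  lift F to Finset S using hF
  exact ⟨F, hFT, hKF⟩

theorem isOpen_units : IsOpen (UnivGroupoid.units : Set (UnivGroupoid S)) := by
  have h : (UnivGroupoid.units : Set (UnivGroupoid S)) =
      ⋃ e ∈ {e : S | IsIdempotentElem e}, bisection e := by
    ext g
    simp only [mem_units_iff_exists_bisection, mem_iUnion₂, mem_ofPred_eq, exists_prop]
  rw [h]
  exact isOpen_biUnion fun e _ => isOpen_bisection e

theorem isClosed_units [T2Space (UnivGroupoid S)] :
    IsClosed (UnivGroupoid.units : Set (UnivGroupoid S)) := by
  refine isOpen_compl_iff.1 (isOpen_of_preimage_germMap fun s => ?_)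
  have hunit : Continuous fun ξ : {ξ : IdemFilter S // s⁻¹ * s ∈ ξ} =>
      germMap (s⁻¹ * s) ⟨ξ.1, by rw [inv_mul_self_of_idem (idem_inv_mul s)]; exact ξ.2⟩ :=
    (continuous_germMap _).comp (continuous_subtype_val.subtype_mk _)
  convert (isClosed_eq (continuous_germMap s) hunit).isOpen_compl using 1
  ext ξ
  exact not_congr (mem_units_iff_eq_germ ξ.2)

theorem isClosed_biUnion_bisection [T2Space (UnivGroupoid S)] (F : Finset S) :
    IsClosed (⋃ m ∈ F, bisection m) :=
  isClosed_biUnion_finset fun m _ => (isCompact_bisection m).isClosed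

/-! ### The map `Φ` -/

section Phi

variable {l : S → ℝ≥0} {g : UnivGroupoid S}

theorem Phi_eq_sInf_image (l : S → ℝ≥0) (g : UnivGroupoid S) :
    Phi l g = sInf (l '' {t | g ∈ bisection t}) := by
  refine congrArg sInf (Set.ext fun r => ?_)
  constructor
  · rintro ⟨t, h, htg, rfl⟩
    exact ⟨t, ⟨⟨g.source, h⟩, htg⟩, rfl⟩
  · rintro ⟨t, ⟨ξ, rfl⟩, rfl⟩
    exact ⟨t, ξ.2, rfl, rfl⟩

theorem image_setOf_mem_bisection_nonempty (l : S → ℝ≥0) (g : UnivGroupoid S) :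
    (l '' {t | g ∈ bisection t}).Nonempty :=
  Set.Nonempty.image l (exists_mem_bisection g)

theorem Phi_le {t : S} (h : g ∈ bisection t) : Phi l g ≤ l t := by
  rw [Phi_eq_sInf_image]
  exact csInf_le (OrderBot.bddBelow _) (mem_image_of_mem l h)

theorem le_Phi {a : ℝ≥0} (h : ∀ t, g ∈ bisection t → a ≤ l t) : a ≤ Phi l g := by
  rw [Phi_eq_sInf_image]
  exact le_csInf (image_setOf_mem_bisection_nonempty l g) (forall_mem_image.2 h)

theorem exists_mem_bisection_lt {a : ℝ≥0} (h : Phi l g < a) : ∃ t, g ∈ bisection t ∧ l t < a := by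
  rw [Phi_eq_sInf_image] at h
  simpa using exists_lt_of_csInf_lt (image_setOf_mem_bisection_nonempty l g) h

theorem IsLength.le_of_natLE (hl : IsLength l) {s t : S} (h : NatLE s t) : l s ≤ l t :=
  calc l s = l (t * (s⁻¹ * s)) := by rw [h.mul_inv_mul_eq]
    _ ≤ l t + l (s⁻¹ * s) := hl.mul_le _ _
    _ = l t := by rw [(hl.eq_zero_iff _).2 (idem_inv_mul s), add_zero]

theorem IsLength.Phi_principalGerm (hl : IsLength l) (s : S) : Phi l (principalGerm s) = l s :=
  le_antisymm (Phi_le (principalGerm_mem_bisection s)) <|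
    le_Phi fun _ h => hl.le_of_natLE (principalGerm_mem_bisection_iff.1 h)

theorem IsLength.Phi_eq_zero (hl : IsLength l) (hg : g ∈ UnivGroupoid.units) : Phi l g = 0 := by
  obtain ⟨e, he, hge⟩ := mem_units_iff_exists_bisection.1 hg
  exact le_antisymm ((Phi_le hge).trans_eq ((hl.eq_zero_iff e).2 he)) zero_le

theorem IsLength.Phi_inv_le (hl : IsLength l) (g : UnivGroupoid S) : Phi l g⁻¹ ≤ Phi l g :=
  le_Phi fun t ht => (Phi_le (inv_mem_bisection_inv ht)).trans_eq (hl.inv t)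

theorem IsLength.Phi_mul_le (hl : IsLength l) {g h : UnivGroupoid S}
    (hgh : g.source = h.range) : Phi l (g * h) ≤ Phi l g + Phi l h := by
  refine le_of_forall_pos_le_add fun ε hε => ?_
  obtain ⟨s, hs, hls⟩ := exists_mem_bisection_lt (lt_add_of_pos_right (Phi l g) (half_pos hε))
  obtain ⟨t, ht, hlt⟩ := exists_mem_bisection_lt (lt_add_of_pos_right (Phi l h) (half_pos hε))
  calc Phi l (g * h) ≤ l (s * t) := Phi_le (mem_bisection_mul_iff.2 ⟨g, hs, h, ht, hgh, rfl⟩)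
    _ ≤ l s + l t := hl.mul_le s t
    _ ≤ (Phi l g + ε / 2) + (Phi l h + ε / 2) := add_le_add hls.le hlt.le
    _ = Phi l g + Phi l h + ε := by rw [add_add_add_comm, add_halves]

theorem UniformlyDiscrete.uniformlyDiscrete_Phi (hd : UniformlyDiscrete l) :
    UnivGroupoid.UniformlyDiscrete (Phi l) := by
  obtain ⟨c, hc, hcl⟩ := hd
  refine ⟨c, hc, fun g hg => le_Phi fun t ht => hcl t fun hti => hg ?_⟩
  exact mem_units_iff_exists_bisection.2 ⟨t, hti, ht⟩

theorem IsLength.isLength_Phi (hl : IsLength l) (hd : UniformlyDiscrete l) :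
    UnivGroupoid.IsLength (Phi l) where
  eq_zero_iff g := by
    obtain ⟨c, hc, hcl⟩ := hd.uniformlyDiscrete_Phi
    exact ⟨fun h => not_imp_comm.1 (hcl g) (h ▸ hc.not_ge), hl.Phi_eq_zero⟩
  inv g := le_antisymm (hl.Phi_inv_le g) <| by
    simpa only [UnivGroupoid.inv_inv] using hl.Phi_inv_le g⁻¹
  mul_le _ _ := hl.Phi_mul_le

theorem controlled_Phi (l : S → ℝ≥0) : UnivGroupoid.Controlled (Phi l) := by
  intro K hK
  obtain ⟨F, -, hF⟩ := exists_finset_bisection_cover (T := univ) hK fun g _ => by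
    simpa using exists_mem_bisection g
  refine ⟨F.sup l, forall_mem_image.2 fun g hg => ?_⟩
  obtain ⟨s, hs, hgs⟩ := mem_iUnion₂.1 (hF (subset_closure hg))
  exact (Phi_le hgs).trans (Finset.le_sup hs)

theorem upperSemicontinuous_Phi (l : S → ℝ≥0) : UpperSemicontinuous (Phi l) := by
  intro g a ha
  obtain ⟨t, hgt, hta⟩ := exists_mem_bisection_lt ha
  filter_upwards [(isOpen_bisection t).mem_nhds hgt] with h hht
  exact (Phi_le hht).trans_lt hta

end Phi

/-! ### The map `Ψ` -/

section Psi

variable {L : UnivGroupoid S → ℝ≥0}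

theorem image_bisection (L : UnivGroupoid S → ℝ≥0) (s : S) :
    L '' bisection s =
      range fun ξ : {ξ : IdemFilter S // s⁻¹ * s ∈ ξ} => L (germ s ξ.1 ξ.2) :=
  (range_comp L (germMap s)).symm

theorem le_Psi {s : S} (hb : BddAbove (L '' bisection s)) {g : UnivGroupoid S}
    (hg : g ∈ bisection s) : L g ≤ Psi L s := by
  obtain ⟨ξ, rfl⟩ := hg
  rw [image_bisection] at hb
  exact le_ciSup hb ξ

theorem Psi_le {s : S} {a : ℝ≥0} (h : ∀ g ∈ bisection s, L g ≤ a) : Psi L s ≤ a :=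
  ciSup_le' fun ξ => h _ (germ_mem_bisection ξ.2)

theorem IsLength.Psi_Phi {l : S → ℝ≥0} (hl : IsLength l) : Psi (Phi l) = l := by
  funext s
  have hb : BddAbove (Phi l '' bisection s) := ⟨l s, forall_mem_image.2 fun _ => Phi_le⟩
  refine le_antisymm (Psi_le fun _ => Phi_le) ?_
  calc l s = Phi l (principalGerm s) := (hl.Phi_principalGerm s).symm
    _ ≤ Psi (Phi l) s := le_Psi hb (principalGerm_mem_bisection s)

theorem injOn_Phi : InjOn (Phi (S := S)) {l | IsLength l} :=
  LeftInvOn.injOn fun _ hl => IsLength.Psi_Phi hl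

theorem UnivGroupoid.IsLength.Psi_le_Psi_inv (hL : UnivGroupoid.IsLength L)
    (hb : ∀ s, BddAbove (L '' bisection s)) (s : S) : Psi L s ≤ Psi L s⁻¹ :=
  Psi_le fun g hg => (hL.inv g).symm.trans_le (le_Psi (hb _) (inv_mem_bisection_inv hg))

theorem UnivGroupoid.IsLength.isLength_Psi (hL : UnivGroupoid.IsLength L)
    (hb : ∀ s, BddAbove (L '' bisection s)) : InverseSemigroup.IsLength (Psi L) where
  eq_zero_iff s := by
    refine ⟨fun h => ?_, fun hs => ?_⟩
    · rw [← principalGerm_mem_units_iff, ← hL.eq_zero_iff, ← nonpos_iff_eq_zero, ← h]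
      exact le_Psi (hb s) (principalGerm_mem_bisection s)
    · refine nonpos_iff_eq_zero.1 (Psi_le fun g hg => ((hL.eq_zero_iff g).2 ?_).le)
      exact mem_units_iff_exists_bisection.2 ⟨s, hs, hg⟩
  inv s := le_antisymm (by simpa only [inv_inv'] using hL.Psi_le_Psi_inv hb s⁻¹)
    (hL.Psi_le_Psi_inv hb s)
  mul_le s t := by
    refine Psi_le fun k hk => ?_
    obtain ⟨g, hg, h, hh, hgh, rfl⟩ := mem_bisection_mul_iff.1 hk
    exact (hL.mul_le g h hgh).trans (add_le_add (le_Psi (hb s) hg) (le_Psi (hb t) hh))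

theorem UnivGroupoid.UniformlyDiscrete.uniformlyDiscrete_Psi
    (hd : UnivGroupoid.UniformlyDiscrete L) (hb : ∀ s, BddAbove (L '' bisection s)) :
    InverseSemigroup.UniformlyDiscrete (Psi L) := by
  obtain ⟨c, hc, hcL⟩ := hd
  refine ⟨c, hc, fun s hs => ?_⟩
  exact (hcL (principalGerm s) (mt principalGerm_mem_units_iff.1 hs)).trans
    (le_Psi (hb s) (principalGerm_mem_bisection s))

theorem UnivGroupoid.Controlled.bddAbove_image_bisection [T2Space (UnivGroupoid S)]
    (hL : UnivGroupoid.Controlled L) (s : S) : BddAbove (L '' bisection s) :=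
  hL _ (isCompact_bisection s).closure

end Psi

/-! ### Properness -/

/-- The non-units on which `L` is at most `r`: the counterpart in the groupoid of the cylinder
`{s | 0 < l(s) ≤ r}` in `S`. Non-units are used instead of the condition `0 < L(g)` because `Φ(l)`
may vanish at non-units when `l` is not uniformly discrete. -/
def UnivGroupoid.cylinder (L : UnivGroupoid S → ℝ≥0) (r : ℝ≥0) : Set (UnivGroupoid S) :=
  {g | g ∉ UnivGroupoid.units ∧ L g ≤ r}

theorem UnivGroupoid.proper_iff_isCompact_closure_cylinder {L : UnivGroupoid S → ℝ≥0} :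
    UnivGroupoid.Proper L ↔ ∀ r, IsCompact (closure (UnivGroupoid.cylinder L r)) := by
  constructor
  · exact fun h r => h _ (fun g hg => hg.1) ⟨r, forall_mem_image.2 fun g hg => hg.2⟩
  · rintro h K hK ⟨r, hr⟩
    have hKr : K ⊆ UnivGroupoid.cylinder L r := fun g hg => ⟨hK hg, hr (mem_image_of_mem L hg)⟩
    exact (h r).of_isClosed_subset isClosed_closure (closure_mono hKr)

section Properness

variable {l : S → ℝ≥0}

theorem Witnesses.cylinder_Phi_subset (hl : IsLength l) {r r' : ℝ≥0} {F : Finset S}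
    (hF : Witnesses l r' F) (hr : r < r') :
    UnivGroupoid.cylinder (Phi l) r ⊆ ⋃ m ∈ F, bisection m := by
  rintro g ⟨hg, hgr⟩
  obtain ⟨t, hgt, hlt⟩ := exists_mem_bisection_lt (hgr.trans_lt hr)
  have hpos : 0 < l t := pos_iff_ne_zero.2 fun h0 =>
    hg (mem_units_iff_exists_bisection.2 ⟨t, (hl.eq_zero_iff t).1 h0, hgt⟩)
  obtain ⟨m, hm, htm⟩ := hF t hpos hlt.le
  exact mem_biUnion hm (htm.bisection_subset hgt)

theorem IsLength.witnesses_of_cylinder_Phi_subset (hl : IsLength l) {r : ℝ≥0} {F : Finset S}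
    (hF : UnivGroupoid.cylinder (Phi l) r ⊆ ⋃ m ∈ F, bisection m) : Witnesses l r F := by
  intro s hs hsr
  have hunits : principalGerm s ∉ UnivGroupoid.units := fun h =>
    hs.ne' ((hl.eq_zero_iff s).2 (principalGerm_mem_units_iff.1 h))
  obtain ⟨m, hm, hsm⟩ := mem_iUnion₂.1 (hF ⟨hunits, (hl.Phi_principalGerm s).trans_le hsr⟩)
  exact ⟨m, hm, principalGerm_mem_bisection_iff.1 hsm⟩

theorem IsLength.proper_Phi [T2Space (UnivGroupoid S)] (hl : IsLength l) (hp : Proper l) :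
    UnivGroupoid.Proper (Phi l) := by
  refine UnivGroupoid.proper_iff_isCompact_closure_cylinder.2 fun r => ?_
  obtain ⟨F, hF⟩ := hp (r + 1)
  exact (F.isCompact_biUnion fun m _ => isCompact_bisection m).closure_of_subset
    (hF.cylinder_Phi_subset hl (lt_add_of_pos_right r one_pos))

theorem IsLength.proper_of_proper_Phi (hl : IsLength l) (hp : UnivGroupoid.Proper (Phi l)) :
    Proper l := by
  intro r
  obtain ⟨F, -, hF⟩ := exists_finset_bisection_cover (T := univ)
    (UnivGroupoid.proper_iff_isCompact_closure_cylinder.1 hp r) fun g _ => by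
      simpa using exists_mem_bisection g
  exact ⟨F, hl.witnesses_of_cylinder_Phi_subset (subset_closure.trans hF)⟩

theorem TightlyProper.proper (ht : TightlyProper l) : Proper l := fun r =>
  (ht r).imp fun _ h => h.1

/-! ### Tight properness -/

theorem IsLength.preimage_Phi_Iic_eq (hl : IsLength l) {F : ℝ≥0 → Finset S}
    (hF : ∀ r, Witnesses l r (F r)) (hFl : ∀ r, ∀ m ∈ F r, l m ≤ r) (r : ℝ≥0) :
    Phi l ⁻¹' Iic r = UnivGroupoid.units ∪ ⋂ r' > r, ⋃ m ∈ F r', bisection m := by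
  ext g
  constructor
  · refine fun hg => or_iff_not_imp_left.2 fun hgu => mem_iInter₂.2 fun r' hr' => ?_
    exact (hF r').cylinder_Phi_subset hl hr' ⟨hgu, hg⟩
  · rintro (hg | hg)
    · exact (hl.Phi_eq_zero hg).trans_le zero_le
    · change Phi l g ≤ r
      refine le_of_forall_gt_imp_ge_of_dense fun r' hr' => ?_
      obtain ⟨m, hm, hgm⟩ := mem_iUnion₂.1 (mem_iInter₂.1 hg r' hr')
      exact (Phi_le hgm).trans (hFl r' m hm)

theorem IsLength.continuous_Phi [T2Space (UnivGroupoid S)] (hl : IsLength l)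
    (ht : TightlyProper l) : Continuous (Phi l) := by
  choose F hF hFl using ht
  refine continuous_iff_lower_upperSemicontinuous.2
    ⟨lowerSemicontinuous_iff_isClosed_preimage.2 fun r => ?_, upperSemicontinuous_Phi l⟩
  rw [hl.preimage_Phi_Iic_eq hF hFl]
  exact isClosed_units.union (isClosed_biInter fun r' _ => isClosed_biUnion_bisection (F r'))

theorem csInf_mem_of_finite_inter_Iic {α : Type*} [ConditionallyCompleteLinearOrder α]
    {A : Set α} (hA : A.Nonempty) (hfin : ∀ a, (A ∩ Iic a).Finite) : sInf A ∈ A := by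
  obtain ⟨a, ha⟩ := hA
  have hmem : sInf (A ∩ Iic a) ∈ A ∩ Iic a := Set.Nonempty.csInf_mem ⟨a, ha, le_rfl⟩ (hfin a)
  have hleast : IsLeast A (sInf (A ∩ Iic a)) := by
    refine ⟨hmem.1, fun b hb => ?_⟩
    rcases le_total b a with hba | hab
    · exact csInf_le (hfin a).bddBelow ⟨hb, hba⟩
    · exact hmem.2.trans hab
  exact hleast.csInf_mem

theorem DiscreteValues.exists_eq_Phi (hd : DiscreteValues l) (g : UnivGroupoid S) :
    ∃ t, g ∈ bisection t ∧ l t = Phi l g := by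
  rw [Phi_eq_sInf_image]
  exact csInf_mem_of_finite_inter_Iic (image_setOf_mem_bisection_nonempty l g) fun a =>
    (hd a).subset (inter_subset_inter_left _ (image_subset_range _ _))

theorem IsLength.tightlyProper_of_Phi (hl : IsLength l) (hd : DiscreteValues l)
    (hp : UnivGroupoid.Proper (Phi l)) (hc : Continuous (Phi l)) : TightlyProper l := by
  intro r
  have hclosed : IsClosed (UnivGroupoid.cylinder (Phi l) r) :=
    isOpen_units.isClosed_compl.inter (isClosed_Iic.preimage hc)
  have hcompact : IsCompact (UnivGroupoid.cylinder (Phi l) r) :=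
    hclosed.closure_eq ▸ UnivGroupoid.proper_iff_isCompact_closure_cylinder.1 hp r
  obtain ⟨F, hFr, hF⟩ := exists_finset_bisection_cover (T := {t | l t ≤ r}) hcompact fun g hg => by
    obtain ⟨t, hgt, ht⟩ := hd.exists_eq_Phi g
    exact ⟨t, ht.trans_le hg.2, hgt⟩
  exact ⟨F, hl.witnesses_of_cylinder_Phi_subset hF, hFr⟩

end Properness

end InverseSemigroup

open InverseSemigroup in
theorem theorem3p27_general {S : Type*} [InverseSemigroup S] [T2Space (UnivGroupoid S)] :
    (∀ l : S → ℝ≥0, IsLength l → UniformlyDiscrete l →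
      UnivGroupoid.IsLength (Phi l) ∧ UnivGroupoid.UniformlyDiscrete (Phi l)) ∧
    (∀ l : S → ℝ≥0, UnivGroupoid.Controlled (Phi l)) ∧
    Set.InjOn (Phi (S := S)) {l | IsLength l} ∧
    (∀ L : UnivGroupoid S → ℝ≥0, UnivGroupoid.Controlled L → ∀ s : S,
      BddAbove (Set.range fun ξ : {ξ : IdemFilter S // s⁻¹ * s ∈ ξ} => L (germ s ξ.1 ξ.2))) ∧
    (∀ L : UnivGroupoid S → ℝ≥0, UnivGroupoid.IsLength L → UnivGroupoid.Controlled L →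
      IsLength (Psi L) ∧ (UnivGroupoid.UniformlyDiscrete L → UniformlyDiscrete (Psi L))) ∧
    (∀ l : S → ℝ≥0, IsLength l → Psi (Phi l) = l) ∧
    (∀ l : S → ℝ≥0, IsLength l → (Proper l ↔ UnivGroupoid.Proper (Phi l))) ∧
    (∀ l : S → ℝ≥0, IsLength l → TightlyProper l →
      UnivGroupoid.Proper (Phi l) ∧ Continuous (Phi l)) ∧
    (∀ l : S → ℝ≥0, IsLength l → DiscreteValues l →
      (TightlyProper l ↔ UnivGroupoid.Proper (Phi l) ∧ Continuous (Phi l))) := by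
  have htight (l : S → ℝ≥0) (hl : IsLength l) (ht : TightlyProper l) :
      UnivGroupoid.Proper (Phi l) ∧ Continuous (Phi l) :=
    ⟨hl.proper_Phi ht.proper, hl.continuous_Phi ht⟩
  refine ⟨?_, controlled_Phi, injOn_Phi, ?_, ?_, fun l hl => hl.Psi_Phi, ?_, htight, ?_⟩
  · exact fun l hl hd => ⟨hl.isLength_Phi hd, hd.uniformlyDiscrete_Phi⟩
  · exact fun L hc s => image_bisection L s ▸ hc.bddAbove_image_bisection s
  · exact fun L hL hc => ⟨hL.isLength_Psi hc.bddAbove_image_bisection,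
      fun hd => hd.uniformlyDiscrete_Psi hc.bddAbove_image_bisection⟩
  · exact fun l hl => ⟨hl.proper_Phi, hl.proper_of_proper_Phi⟩
  · exact fun l hl hd => ⟨htight l hl, fun h => hl.tightlyProper_of_Phi hd h.1 h.2⟩

open InverseSemigroup in
theorem theorem3p27 {S : Type*} [InverseSemigroup S] (hS : QuasiCountable S)
    [T2Space (UnivGroupoid S)] :
    -- `Φ` maps length functions of `S` to controlled length functions of the groupoid
    (∀ l : S → ℝ≥0, IsLength l → UniformlyDiscrete l →
      UnivGroupoid.IsLength (Phi l) ∧ UnivGroupoid.UniformlyDiscrete (Phi l)) ∧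
    (∀ l : S → ℝ≥0, IsLength l → UnivGroupoid.Controlled (Phi l)) ∧
    -- `Φ` is injective
    Set.InjOn (Phi (S := S)) {l | IsLength l} ∧
    -- `Ψ` (whose suprema are finite) maps controlled length functions to length functions
    (∀ L : UnivGroupoid S → ℝ≥0, UnivGroupoid.Controlled L → ∀ s : S,
      BddAbove (Set.range fun ξ : {ξ : IdemFilter S // s⁻¹ * s ∈ ξ} => L (germ s ξ.1 ξ.2))) ∧
    (∀ L : UnivGroupoid S → ℝ≥0, UnivGroupoid.IsLength L → UnivGroupoid.Controlled L →
      IsLength (Psi L) ∧ (UnivGroupoid.UniformlyDiscrete L → UniformlyDiscrete (Psi L))) ∧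
    -- `Ψ` is a left inverse of `Φ`
    (∀ l : S → ℝ≥0, IsLength l → Psi (Phi l) = l) ∧
    -- properness
    (∀ l : S → ℝ≥0, IsLength l → (Proper l ↔ UnivGroupoid.Proper (Phi l))) ∧
    -- tight properness
    (∀ l : S → ℝ≥0, IsLength l → TightlyProper l →
      UnivGroupoid.Proper (Phi l) ∧ Continuous (Phi l)) ∧
    (∀ l : S → ℝ≥0, IsLength l → DiscreteValues l →
      (TightlyProper l ↔ UnivGroupoid.Proper (Phi l) ∧ Continuous (Phi l))) := by
  obtain ⟨hlength, hcontrolled, hrest⟩ := theorem3p27_general (S := S)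
  exact ⟨hlength, fun l _ => hcontrolled l, hrest⟩
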